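/- The variable-processor cup game on $n\ge 1$ cups is played as follows. The fills $x_1,\dots,x_n$ start at $0$. In each round the filler chooses an integer $1\le p\le n$ and reals $a_1,\dots,a_n\in[0,1]$ with $\sum_{i=1}^n a_i=p$, and replaces each $x_i$ by $x_i+a_i$; then the emptier, seeing this, chooses a set $S\subseteq\{1,\dots,n\}$ with $|S|=p$ and replaces $x_i$ by $\max(0,x_i-1)$ for each $i\in S$. Both players are adaptive: their choices may depend on everything that has happened so far. The backlog is $\max_i x_i$. We say that the filler can force backlog $b$ after $t$ rounds if there is a filler strategy such that, against every emptier strategy, the backlog at the end of round $t$ is at least $b$. All logarithms are natural. Theorem. 1. There are absolute constants $0<c<1$, $\beta>0$, $C>0$ such that for every positive integer $n$ and every real $k$ with $1\le k\le cn$, there is an integer $T\ge 0$ with $$T\le C\left(k+\frac{k^3}{\log^2(n/k)}\right)$$ such that the filler can force backlog $\beta k$ after $T$ rounds of the game on $n$ cups. 2. Consequently the filler attains the lower half of the trade-off curve: there is an absolute constant $\beta>0$ such that for all integers $n\ge 2$ and $t\ge 1$ the filler can force backlog $\beta\, b(t)$ after $t$ rounds of the game on $n$ cups, where $$b(t)=\begin{cases}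 t & \text{if } t\le \log n,\\ t^{1/3}\log^{2/3}\!\left(\frac{n^3}{t}+1\right) & \text{if } \log n<t\le n^3,\\ n & \text{if } t>n^3.\end{cases}$$ 3. In particular, there are absolute constants $\beta>0$, $C>0$ such that for every integer $n\ge 2$ there is an integer $T$ with $0\le T\le Cn^3$ such that the filler can force backlog $\beta n$ after $T$ rounds of the game on $n$ cups. -/

import Mathlib

namespace CupGame

/-- A legal filler move on `n` cups: an integer `1 ≤ p ≤ n` and amounts `a i ∈ [0, 1]`
with total `p`. -/
structure FillerMove (n : ℕ) where
  p : ℕ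
  a : Fin n → ℝ
  one_le_p : 1 ≤ p
  p_le : p ≤ n
  a_nonneg : ∀ i, 0 ≤ a i
  a_le_one : ∀ i, a i ≤ 1
  sum_a : ∑ i, a i = (p : ℝ)

/-- A legal answer of the emptier to the filler move `m`: a set of exactly `p` cups. -/
abbrev EmptierMove {n : ℕ} (m : FillerMove n) : Type :=
  {S : Finset (Fin n) // S.card = m.p}

/-- One round: the move of the filler followed by the answer of the emptier. -/
structure Round (n : ℕ) where
  fill : FillerMove n
  empty : EmptierMove fill

/-- The fills at the end of a round that starts with fills `x`: first `a i` is added to every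
cup, then up to one unit is removed from each cup chosen by the emptier. -/
noncomputable def Round.apply {n : ℕ} (r : Round n) (x : Fin n → ℝ) : Fin n → ℝ :=
  fun i => if i ∈ r.empty.val then max 0 (x i + r.fill.a i - 1) else x i + r.fill.a i

/-- The fills after a finite history of rounds (the most recent round is the head of the list),
starting from empty cups. -/
noncomputable def state {n : ℕ} : List (Round n) → Fin n → ℝ
  | [] => fun _ => 0
  | r :: h => r.apply (state h)

/-- The fill of the fullest cup. -/
noncomputable def backlog {n : ℕ} (x : Fin n → ℝ) : ℝ := ⨆ i, x i

/-- An adaptive filler: chooses a move from everything that has happened in earlier rounds. -/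
abbrev FillerStrategy (n : ℕ) : Type := List (Round n) → FillerMove n

/-- An adaptive emptier: chooses the cups from everything that has happened in earlier rounds
and the filler's move in the current round. -/
abbrev EmptierStrategy (n : ℕ) : Type := List (Round n) → (m : FillerMove n) → EmptierMove m

/-- The history of the first `t` rounds when the two strategies are played against each other. -/
def history {n : ℕ} (σ : FillerStrategy n) (ε : EmptierStrategy n) : ℕ → List (Round n)
  | 0 => []
  | t + 1 => ⟨σ (history σ ε t), ε (history σ ε t) (σ (history σ ε t))⟩ :: history σ ε t

/-- In the variable-processor cup game on `n` cups, the filler has a strategy that guarantees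
backlog at least `b` after `t` rounds, whatever the emptier does. -/
def FillerCanForce (n t : ℕ) (b : ℝ) : Prop :=
  ∃ σ : FillerStrategy n, ∀ ε : EmptierStrategy n, b ≤ backlog (state (history σ ε t))

/-- The trade-off curve `b(t)` for `n` cups. -/
noncomputable def tradeoff (n t : ℕ) : ℝ :=
  if (t : ℝ) ≤ Real.log n then (t : ℝ)
  else if t ≤ n ^ 3 then
    (t : ℝ) ^ (1 / 3 : ℝ) * Real.log ((n : ℝ) ^ 3 / (t : ℝ) + 1) ^ (2 / 3 : ℝ)
  else (n : ℝ)

end CupGame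

namespace CupGame

/-! The filler plays only split moves: 2m cups at a common height j get 1/2 each, and every cup
above j gets 1. Fills stay in (1/2)ℕ. By convexity of max(0, x - g), no answer lowers any `excess
g`, and `excess j` grows by at least m/2 (`excess_split`).

Let the excess above h be at least B. Unless B/4 of excess already lies above h + d, some level in
[h, h + 2d) is crowded, and splitting it repeatedly makes the excess above h double or a quarter of
B pass h + d within 1024d³ rounds (`wins_epoch`). Each climb costs a factor 4 of excess and
doublings are limited because the excess is bounded until a cup is high enough, so O(S) epochs climb
S steps of size d (`wins_stages`). With L = log(n/k), S about L/2 and d about k/L give backlog of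
order k in O(k³/L²) rounds; if k ≤ L, d = 1 gives O(k). The curve follows by inverting this time
bound. -/

/-! ### Reduction to a recursive game value, and holding a backlog -/

/-- The filler can guarantee backlog at least `K` after `t` further rounds, starting from the
fills `x`. -/
def Wins {n : ℕ} (K : ℝ) : ℕ → (Fin n → ℝ) → Prop
  | 0, x => K ≤ backlog x
  | t + 1, x => ∃ m : FillerMove n, ∀ e : EmptierMove m, Wins K t (Round.apply ⟨m, e⟩ x)

theorem length_history {n : ℕ} (σ : FillerStrategy n) (ε : EmptierStrategy n) (t : ℕ) :
    (history σ ε t).length = t := by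
  induction t with
  | zero => rfl
  | succ t ih => simp [history, ih]

open Classical in
theorem Wins.fillerCanForce {n t : ℕ} {K : ℝ} (m₀ : FillerMove n)
    (h : Wins K t (fun _ : Fin n => (0 : ℝ))) : FillerCanForce n t K := by
  -- The default `m₀` is never played before time `t`: a winning move exists at each earlier
  -- history.
  let σ : FillerStrategy n := fun l =>
    if h : ∃ m : FillerMove n, ∀ e : EmptierMove m,
      Wins K (t - l.length - 1) (Round.apply ⟨m, e⟩ (state l)) then h.choose else m₀
  refine ⟨σ, fun ε => ?_⟩
  have key : ∀ s, s ≤ t → Wins K (t - s) (state (history σ ε s)) := by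
    intro s
    induction s with
    | zero => intro _; exact h
    | succ s ih =>
      intro hs
      have h1 := ih (by omega)
      obtain ⟨r, hr⟩ : ∃ r, t - s = r + 1 := ⟨t - s - 1, by omega⟩
      rw [hr] at h1
      have h2 : ∃ m : FillerMove n, ∀ e : EmptierMove m,
          Wins K (t - (history σ ε s).length - 1)
            (Round.apply ⟨m, e⟩ (state (history σ ε s))) := by
        rw [length_history, hr]; exact h1
      have h3 : σ (history σ ε s) = h2.choose := dif_pos h2
      have h4 := h2.choose_spec
      rw [← h3, length_history] at h4
      have h5 : t - s - 1 = t - (s + 1) := by omega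
      rw [h5] at h4
      exact h4 _
  simpa [Wins] using key t le_rfl

/-- The move that adds one unit to the single cup `i`. -/
def holdMove {n : ℕ} (i : Fin n) : FillerMove n where
  p := 1
  a := fun j => if j = i then 1 else 0
  one_le_p := le_rfl
  p_le := i.pos
  a_nonneg := fun j => by split_ifs <;> norm_num
  a_le_one := fun j => by split_ifs <;> norm_num
  sum_a := by simp

theorem le_backlog {n : ℕ} (x : Fin n → ℝ) (i : Fin n) : x i ≤ backlog x :=
  le_ciSup (Set.finite_range x).bddAbove i

theorem wins_of_le {n : ℕ} {K : ℝ} (t : ℕ) {x : Fin n → ℝ} {i : Fin n} (h : K ≤ x i) :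
    Wins K t x := by
  induction t generalizing x with
  | zero => exact h.trans (le_backlog x i)
  | succ t ih =>
    refine ⟨holdMove i, fun e => ih ?_⟩
    simp only [Round.apply, holdMove, if_true]
    split_ifs
    · exact h.trans (by simp)
    · linarith

theorem Wins.add {n : ℕ} {K : ℝ} {t : ℕ} (hn : 0 < n) (s : ℕ) {x : Fin n → ℝ}
    (h : Wins K t x) : Wins K (t + s) x := by
  induction t generalizing x with
  | zero =>
    have : Nonempty (Fin n) := ⟨⟨0, hn⟩⟩
    obtain ⟨i, hi⟩ := exists_eq_ciSup_of_finite (f := x)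
    refine wins_of_le _ (i := i) ?_
    rw [hi]; exact h
  | succ t ih =>
    obtain ⟨m, hm⟩ := h
    rw [Nat.add_right_comm]
    exact ⟨m, fun e => ih (hm e)⟩

theorem Wins.mono {n : ℕ} {K : ℝ} {s t : ℕ} (hn : 0 < n) (hst : s ≤ t) {x : Fin n → ℝ}
    (h : Wins K s x) : Wins K t x := by
  obtain ⟨r, rfl⟩ := Nat.exists_eq_add_of_le hst
  exact h.add hn r

/-! ### Split moves and monotonicity of the excess -/

/-- Every fill is a nonnegative half-integer. -/
def HalfIntegral {n : ℕ} (x : Fin n → ℝ) : Prop := ∀ i, ∃ z : ℕ, x i = z / 2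

/-- The total fill above height `g`. -/
noncomputable def excess {n : ℕ} (g : ℝ) (x : Fin n → ℝ) : ℝ := ∑ i, max 0 (x i - g)

theorem excess_anti {n : ℕ} {g g' : ℝ} (h : g ≤ g') (x : Fin n → ℝ) :
    excess g' x ≤ excess g x :=
  Finset.sum_le_sum fun i _ => max_le_max le_rfl (by linarith)

theorem exists_lt_of_excess_pos {n : ℕ} {g : ℝ} {x : Fin n → ℝ} (h : 0 < excess g x) :
    ∃ i, g < x i := by
  obtain ⟨i, -, hi⟩ := Finset.exists_lt_of_sum_lt
    (s := Finset.univ) (f := fun _ : Fin n => (0 : ℝ)) (g := fun i => max 0 (x i - g))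
    (by simpa [excess] using h)
  refine ⟨i, ?_⟩
  rcases lt_max_iff.1 hi with h | h
  · exact absurd h (lt_irrefl _)
  · linarith

theorem exists_le_of_le_excess {n : ℕ} {K g : ℝ} (hn : 0 < n) (hg : g < K) {x : Fin n → ℝ}
    (h : n * (K - g) ≤ excess g x) : ∃ i, K ≤ x i := by
  by_contra! hx
  have : Nonempty (Fin n) := ⟨⟨0, hn⟩⟩
  have : excess g x < ∑ _i : Fin n, (K - g) :=
    Finset.sum_lt_sum_of_nonempty Finset.univ_nonempty
      fun i _ => max_lt (by linarith) (by linarith [hx i])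
  simp at this
  linarith

/-- The move that splits the cups of `W`, all of which are at height `j`: they receive `1/2`
each, the cups higher than `j` receive `1`. -/
noncomputable def splitMove {n : ℕ} (x : Fin n → ℝ) (j : ℝ) (W : Finset (Fin n)) (m : ℕ)
    (hm : 1 ≤ m) (hW : W.card = 2 * m) (hj : ∀ i ∈ W, x i = j) : FillerMove n where
  p := m + (Finset.univ.filter fun i => j < x i).card
  a := fun i => (if i ∈ W then 1 / 2 else 0) + (if j < x i then 1 else 0)
  one_le_p := by omega
  p_le := by
    have hd : Disjoint W (Finset.univ.filter fun i => j < x i) := by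
      rw [Finset.disjoint_left]
      intro i hi h
      have := hj i hi
      simp at h
      linarith
    have h1 := Finset.card_union_of_disjoint hd
    have h2 := Finset.card_le_univ (W ∪ Finset.univ.filter fun i => j < x i)
    rw [Fintype.card_fin] at h2
    omega
  a_nonneg := fun i => by split_ifs <;> norm_num
  a_le_one := fun i => by
    by_cases h : i ∈ W
    · have := hj i h
      simp only [h, this, lt_irrefl, if_true, if_false]
      norm_num
    · simp only [h, if_false]
      split_ifs <;> norm_num
  sum_a := by
    rw [Finset.sum_add_distrib]
    simp [hW]
    ring

theorem HalfIntegral.split {n : ℕ} {x : Fin n → ℝ} (hx : HalfIntegral x) {j : ℝ}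
    {W : Finset (Fin n)} {m : ℕ} (hm : 1 ≤ m) (hW : W.card = 2 * m) (hj : ∀ i ∈ W, x i = j)
    (e : EmptierMove (splitMove x j W m hm hW hj)) :
    HalfIntegral (Round.apply ⟨splitMove x j W m hm hW hj, e⟩ x) := by
  intro i
  obtain ⟨z, hz⟩ := hx i
  obtain ⟨y, hy⟩ : ∃ y : ℕ, x i + (splitMove x j W m hm hW hj).a i = y / 2 := by
    simp only [splitMove, hz]
    split_ifs
    · exact ⟨z + 3, by push_cast; ring⟩
    · exact ⟨z + 1, by push_cast; ring⟩
    · exact ⟨z + 2, by push_cast; ring⟩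
    · exact ⟨z, by ring⟩
  simp only [Round.apply, hy]
  split_ifs
  · rcases le_total y 2 with h | h
    · refine ⟨0, ?_⟩
      have : (y : ℝ) ≤ 2 := by exact_mod_cast h
      rw [max_eq_left (by linarith)]; simp
    · refine ⟨y - 2, ?_⟩
      have : (2 : ℝ) ≤ y := by exact_mod_cast h
      rw [max_eq_right (by linarith)]
      push_cast [h]; ring
  · exact ⟨y, rfl⟩

/-- Write φ(x) = max(0, x - g), and let s be the increment of φ from j - 1/2 to j + 1/2. By
convexity a cup above j gains at least s if spared, while a cup outside W at height at most j loses
at most s if emptied. So each emptied cup can be charged exactly s, and the total depends only on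
|S|, not on the choice of S. -/
theorem excess_split {n : ℕ} {x : Fin n → ℝ} (hx : HalfIntegral x) {j : ℝ} (hjz : ∃ z : ℤ, j = z / 2)
    {W : Finset (Fin n)} {m : ℕ} (hm : 1 ≤ m) (hW : W.card = 2 * m) (hj : ∀ i ∈ W, x i = j)
    (e : EmptierMove (splitMove x j W m hm hW hj)) (g : ℝ) :
    excess g x + m * (max 0 (j + 1 / 2 - g) + max 0 (j - 1 / 2 - g) - 2 * max 0 (j - g)) ≤
      excess g (Round.apply ⟨splitMove x j W m hm hW hj, e⟩ x) := by
  obtain ⟨S, hS⟩ := e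
  set s := max 0 (j + 1 / 2 - g) - max 0 (j - 1 / 2 - g) with hs
  have hstep : ∀ i, j < x i → j + 1 / 2 ≤ x i := by
    intro i hi
    obtain ⟨z, hz⟩ := hx i
    obtain ⟨y, hy⟩ := hjz
    rw [hz, hy] at hi ⊢
    have : (y : ℝ) < ((z : ℤ) : ℝ) := by push_cast; linarith
    have h2 : y + 1 ≤ (z : ℤ) := by exact_mod_cast this
    have h3 : ((y : ℝ) + 1) ≤ ((z : ℤ) : ℝ) := by exact_mod_cast h2
    push_cast at h3
    linarith
  have key : ∀ i, max 0 (x i - g) + (if j < x i then s else 0)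
      + (if i ∈ W then max 0 (j + 1 / 2 - g) - max 0 (j - g) else 0) - (if i ∈ S then s else 0) ≤
      max 0 (Round.apply ⟨splitMove x j W m hm hW hj, ⟨S, hS⟩⟩ x i - g) := by
    intro i
    simp only [Round.apply, splitMove]
    by_cases hiW : i ∈ W
    · have h := hj i hiW
      simp only [h, hiW, lt_irrefl, if_true, if_false]
      split_ifs
      · have := le_max_right 0 (j + (1 / 2 + 0) - 1)
        have h3 : max 0 (j - 1 / 2 - g) ≤ max 0 (max 0 (j + (1 / 2 + 0) - 1) - g) :=
          max_le_max le_rfl (by linarith)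
        linarith
      · have h3 : max 0 (j + 1 / 2 - g) ≤ max 0 (j + (1 / 2 + 0) - g) :=
          max_le_max le_rfl (by linarith)
        linarith
    · simp only [hiW, if_false]
      by_cases hij : j < x i
      · have h1 := hstep i hij
        simp only [hij, if_true]
        split_ifs
        · have h3 : max 0 (x i - g) ≤ max 0 (max 0 (x i + (0 + 1) - 1) - g) :=
            max_le_max le_rfl (by linarith [le_max_right 0 (x i + (0 + 1) - 1)])
          linarith
        · have h3 : max 0 (x i + 1 - g) ≤ max 0 (x i + (0 + 1) - g) :=
            max_le_max le_rfl (by linarith)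
          refine le_trans ?_ h3
          rw [hs]
          rcases max_cases 0 (x i - g) with h | h <;>
          rcases max_cases 0 (j + 1 / 2 - g) with h' | h' <;>
          rcases max_cases 0 (j - 1 / 2 - g) with h'' | h'' <;>
          linarith [le_max_right 0 (x i + 1 - g), le_max_left 0 (x i + 1 - g)]
      · simp only [hij, if_false]
        split_ifs
        · have h3 : max 0 (x i - 1 - g) ≤ max 0 (max 0 (x i + (0 + 0) - 1) - g) :=
            max_le_max le_rfl (by linarith [le_max_right 0 (x i + (0 + 0) - 1)])
          refine le_trans ?_ h3
          push Not at hij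
          rw [hs]
          rcases max_cases 0 (x i - g) with h | h <;>
          rcases max_cases 0 (j + 1 / 2 - g) with h' | h' <;>
          rcases max_cases 0 (j - 1 / 2 - g) with h'' | h'' <;>
          linarith [le_max_right 0 (x i - 1 - g), le_max_left 0 (x i - 1 - g)]
        · simp
  have hsum := Finset.sum_le_sum fun i (_ : i ∈ Finset.univ) => key i
  have hc : (S.card : ℝ) = m + (Finset.univ.filter fun i => j < x i).card := by
    rw [hS]; simp [splitMove]
  simp only [Finset.sum_add_distrib, Finset.sum_sub_distrib, Finset.sum_ite_mem,
    Finset.univ_inter, Finset.sum_const, nsmul_eq_mul, hW, hc, ← Finset.sum_filter] at hsum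
  push_cast at hsum
  unfold excess
  rw [hs] at hsum
  linarith

theorem excess_le_split {n : ℕ} {x : Fin n → ℝ} (hx : HalfIntegral x) {j : ℝ}
    (hjz : ∃ z : ℤ, j = z / 2) {W : Finset (Fin n)} {m : ℕ} (hm : 1 ≤ m) (hW : W.card = 2 * m)
    (hj : ∀ i ∈ W, x i = j) (e : EmptierMove (splitMove x j W m hm hW hj)) (g : ℝ) :
    excess g x ≤ excess g (Round.apply ⟨splitMove x j W m hm hW hj, e⟩ x) := by
  refine le_trans ?_ (excess_split hx hjz hm hW hj e g)
  have : 0 ≤ max 0 (j + 1 / 2 - g) + max 0 (j - 1 / 2 - g) - 2 * max 0 (j - g) := by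
    rcases max_cases 0 (j - g) with h | h <;>
    linarith [le_max_left 0 (j + 1 / 2 - g), le_max_left 0 (j - 1 / 2 - g),
      le_max_right 0 (j + 1 / 2 - g), le_max_right 0 (j - 1 / 2 - g)]
  have := mul_nonneg (Nat.cast_nonneg (α := ℝ) m) this
  linarith

theorem excess_add_le_split {n : ℕ} {x : Fin n → ℝ} (hx : HalfIntegral x) {j : ℝ}
    (hjz : ∃ z : ℤ, j = z / 2) {W : Finset (Fin n)} {m : ℕ} (hm : 1 ≤ m) (hW : W.card = 2 * m)
    (hj : ∀ i ∈ W, x i = j) (e : EmptierMove (splitMove x j W m hm hW hj)) :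
    excess j x + m / 2 ≤ excess j (Round.apply ⟨splitMove x j W m hm hW hj, e⟩ x) := by
  have h := excess_split hx hjz hm hW hj e j
  have h1 : max 0 (j + 1 / 2 - j) = 1 / 2 := by rw [max_eq_right] <;> linarith
  have h2 : max 0 (j - 1 / 2 - j) = 0 := by rw [max_eq_left]; linarith
  rw [h1, h2, sub_self, max_self] at h
  linarith

/-! ### Crowded levels and the epoch argument -/

/-- A crowded level exists as long as the excess sits mostly in a window of width `2 * d`. -/
theorem exists_crowded_level {n d : ℕ} (hd : 1 ≤ d) {h : ℤ} {B : ℝ} {x : Fin n → ℝ}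
    (hx : HalfIntegral x) (hB : B ≤ excess h x) (hB' : excess (h + d) x ≤ B / 4) :
    ∃ l ∈ Finset.range (4 * d),
      B / (16 * d ^ 2) ≤ (Finset.univ.filter fun i => x i = h + l / 2).card := by
  have hd0 : (0 : ℝ) < d := by exact_mod_cast hd
  by_contra! hcon
  -- Cups above h + 2d are paid for by twice their excess over h + d, at most B/2 in total. The
  -- other B/2 comes from cups on 4d levels, each contributing at most 2d.
  have key : ∀ i, max 0 (x i - h) ≤ 2 * max 0 (x i - (h + d)) +
      2 * d * ∑ l ∈ Finset.range (4 * d), (if x i = h + l / 2 then 1 else 0) := by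
    intro i
    have hnn : ∀ l ∈ Finset.range (4 * d), (0 : ℝ) ≤ if x i = h + (l : ℝ) / 2 then 1 else 0 :=
      fun l _ => by split_ifs <;> norm_num
    rcases le_or_gt (x i) h with h1 | h1
    · rw [max_eq_left (by linarith)]
      have := Finset.sum_nonneg hnn
      have := le_max_left 0 (x i - (h + d))
      positivity
    rcases le_or_gt ((h : ℝ) + 2 * d) (x i) with h2 | h2
    · have h3 := mul_nonneg (by positivity : (0 : ℝ) ≤ 2 * d) (Finset.sum_nonneg hnn)
      rw [max_eq_right (by linarith)]
      have := le_max_right 0 (x i - (h + d))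
      linarith
    · obtain ⟨z, hz⟩ := hx i
      rw [hz] at h1 h2
      have h1' : 2 * h < z := by
        have : ((2 * h : ℤ) : ℝ) < ((z : ℤ) : ℝ) := by push_cast; linarith
        exact_mod_cast this
      have h2' : (z : ℤ) < 2 * h + 4 * d := by
        have : ((z : ℤ) : ℝ) < ((2 * h + 4 * d : ℤ) : ℝ) := by push_cast; linarith
        exact_mod_cast this
      have hl : ((((z - 2 * h : ℤ).toNat : ℕ) : ℤ) : ℝ) = z - 2 * h := by
        rw [Int.toNat_of_nonneg (by omega)]; push_cast; ring
      have h3 := Finset.single_le_sum hnn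
        (Finset.mem_range.2 (by omega : ((z : ℤ) - 2 * h).toNat < 4 * d))
      rw [if_pos (by rw [hz]; push_cast at hl ⊢; rw [hl]; ring)] at h3
      rw [hz, max_eq_right (by linarith)]
      rw [hz] at h3
      have := le_max_left 0 ((z : ℝ) / 2 - (h + d))
      nlinarith
  have hsum := Finset.sum_le_sum fun i (_ : i ∈ Finset.univ) => key i
  rw [Finset.sum_add_distrib, ← Finset.mul_sum, ← Finset.mul_sum, Finset.sum_comm] at hsum
  have hlt : ∑ l ∈ Finset.range (4 * d), ∑ i, (if x i = h + (l : ℝ) / 2 then (1 : ℝ) else 0) <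
      ∑ l ∈ Finset.range (4 * d), B / (16 * d ^ 2) := by
    refine Finset.sum_lt_sum_of_nonempty ⟨0, Finset.mem_range.2 (by omega)⟩ fun l hl => ?_
    simpa using hcon l hl
  simp only [Finset.sum_const, Finset.card_range, nsmul_eq_mul] at hlt
  push_cast at hlt
  have h5 : 2 * (d : ℝ) * (4 * d * (B / (16 * d ^ 2))) = B / 2 := by field_simp; ring
  have h6 := mul_lt_mul_of_pos_left hlt (by positivity : (0 : ℝ) < 2 * d)
  unfold excess at hB hB'
  linarith

/-- Within about `1024 * d ^ 3` rounds the excess above `h` doubles, or a quarter of it moves up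
by `d`. -/
theorem wins_epoch {n d t : ℕ} (hn : 0 < n) (hd : 1 ≤ d) {h : ℤ} {B K : ℝ}
    (hB : 32 * (d : ℝ) ^ 2 ≤ B)
    (H : ∀ y : Fin n → ℝ, HalfIntegral y →
      2 * B ≤ excess h y ∨ B / 4 ≤ excess (h + d) y → Wins K t y)
    (r : ℕ) {x : Fin n → ℝ} (hx : HalfIntegral x) (hxB : B ≤ excess h x)
    (hr : 8 * d * B ≤ ∑ l ∈ Finset.range (4 * d), excess (h + (l : ℝ) / 2) x
      + r * (B / (128 * d ^ 2))) :
    Wins K (t + r) x := by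
  have hd0 : (0 : ℝ) < d := by exact_mod_cast hd
  have hB0 : 0 < B := lt_of_lt_of_le (by positivity) hB
  induction r generalizing x with
  | zero =>
    refine H x hx (Or.inl ?_)
    have h1 : ∑ l ∈ Finset.range (4 * d), excess (h + (l : ℝ) / 2) x ≤
        ∑ l ∈ Finset.range (4 * d), excess h x :=
      Finset.sum_le_sum fun l _ => excess_anti (by linarith [Nat.cast_nonneg (α := ℝ) l]) x
    simp only [Finset.sum_const, Finset.card_range, nsmul_eq_mul] at h1
    push_cast at h1 hr
    have h2 : 4 * d * (2 * B) ≤ 4 * d * excess h x := by linarith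
    exact le_of_mul_le_mul_left h2 (by positivity)
  | succ r ih =>
    by_cases hdone : 2 * B ≤ excess h x ∨ B / 4 ≤ excess (h + d) x
    · exact (H x hx hdone).add hn _
    push Not at hdone
    obtain ⟨l, hl, hc⟩ := exists_crowded_level hd hx hxB hdone.2.le
    set F := Finset.univ.filter fun i => x i = h + (l : ℝ) / 2 with hF
    -- The bound 32d² ≤ B is what puts at least two cups on the crowded level.
    have hc2 : (2 : ℝ) ≤ F.card := by
      refine le_trans ?_ hc
      rw [le_div_iff₀ (by positivity)]
      linarith
    have hc2' : 2 ≤ F.card := by exact_mod_cast hc2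
    obtain ⟨W, hWF, hW⟩ := Finset.exists_subset_card_eq
      (show 2 * (F.card / 2) ≤ F.card by omega)
    have hm : 1 ≤ F.card / 2 := by omega
    have hj : ∀ i ∈ W, x i = h + (l : ℝ) / 2 := fun i hi => by simpa [hF] using hWF hi
    have hjz : ∃ z : ℤ, (h : ℝ) + (l : ℝ) / 2 = z / 2 := ⟨2 * h + l, by push_cast; ring⟩
    refine ⟨splitMove x _ W _ hm hW hj, fun e => ih (hx.split hm hW hj e)
      (hxB.trans (excess_le_split hx hjz hm hW hj e _)) ?_⟩
    have hgain : ∑ l' ∈ Finset.range (4 * d), (excess (h + (l' : ℝ) / 2) x +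
        (if l' = l then ((F.card / 2 : ℕ) : ℝ) / 2 else 0)) ≤
        ∑ l' ∈ Finset.range (4 * d), excess (h + (l' : ℝ) / 2)
          (Round.apply ⟨splitMove x _ W _ hm hW hj, e⟩ x) := by
      refine Finset.sum_le_sum fun l' _ => ?_
      split_ifs with hl'
      · subst hl'
        exact excess_add_le_split hx hjz hm hW hj e
      · rw [add_zero]
        exact excess_le_split hx hjz hm hW hj e _
    rw [Finset.sum_add_distrib, Finset.sum_ite_eq' _ l, if_pos hl] at hgain
    -- Rounding to an even number of cups costs at most a factor 2, so the summed excess grows by at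
    -- least |F|/8 per round.
    have h4 : (F.card : ℝ) ≤ 4 * ((F.card / 2 : ℕ) : ℝ) := by
      have : F.card ≤ 4 * (F.card / 2) := by omega
      exact_mod_cast this
    have h5 : B / (16 * (d : ℝ) ^ 2) = 8 * (B / (128 * d ^ 2)) := by field_simp; ring
    push_cast at hr
    linarith

/-! ### Climbing in stages -/

/-- Here r counts the climbs still needed and w the doublings still possible. A doubling lowers w by
1; a climb lowers r by 1 but, quartering B, raises w by 2. Thus 3r + w drops in every epoch. The
reserve D·4^r keeps B large enough to split after all quarterings. -/
theorem wins_stages {n d S : ℕ} (hn : 0 < n) (hd : 1 ≤ d) {D : ℝ} (hD : 32 * (d : ℝ) ^ 2 ≤ D)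
    (q : ℕ) : ∀ (r w : ℕ) (B : ℝ) (x : Fin n → ℝ), 3 * r + w ≤ q → r ≤ S + 1 → HalfIntegral x →
      D * 4 ^ r ≤ B → n * ((S + 1) * d) ≤ B * 2 ^ w →
      B ≤ excess (((S : ℤ) - r) * d : ℤ) x → Wins (S * d : ℝ) (q * (1024 * d ^ 3)) x := by
  have hd0 : (0 : ℝ) < d := by exact_mod_cast hd
  have hD0 : 0 < D := lt_of_lt_of_le (by positivity) hD
  induction q with
  | zero =>
    intro r w B x hq hrS hx hB hw hxB
    obtain rfl : r = 0 := by omega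
    have hB0 : 0 < B := lt_of_lt_of_le (by positivity) hB
    obtain ⟨i, hi⟩ := exists_lt_of_excess_pos (hB0.trans_le hxB)
    push_cast at hi
    exact wins_of_le _ (i := i) (by linarith)
  | succ q ih =>
    intro r w B x hq hrS hx hB hw hxB
    have hB0 : 0 < B := lt_of_lt_of_le (by positivity) hB
    rcases Nat.eq_zero_or_pos r with rfl | hr
    · obtain ⟨i, hi⟩ := exists_lt_of_excess_pos (hB0.trans_le hxB)
      push_cast at hi
      exact wins_of_le _ (i := i) (by linarith)
    obtain ⟨r, rfl⟩ := Nat.exists_eq_add_of_le' hr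
    have hrS' : (r : ℝ) ≤ S := by exact_mod_cast (by omega : r ≤ S)
    have hDB : D ≤ B := le_trans (le_mul_of_one_le_right hD0.le (one_le_pow₀ (by norm_num))) hB
    rw [Nat.add_one_mul]
    refine wins_epoch hn hd (hD.trans hDB) (h := ((S : ℤ) - (r + 1 : ℕ)) * d) ?_ _ hx hxB ?_
    · rintro y hy (h2 | h2)
      -- At w = 0 the excess is so large that averaging over the n cups already gives one of height
      -- Sd.
      · rcases Nat.eq_zero_or_pos w with rfl | hw0
        · obtain ⟨i, hi⟩ := exists_le_of_le_excess (K := (S * d : ℝ)) (x := y)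
            (g := (((S : ℤ) - (r + 1 : ℕ)) * d : ℤ)) hn (by push_cast; nlinarith) (by
              push_cast at hw h2 ⊢
              have : (n : ℝ) * (S * d - (S - (r + 1)) * d) ≤ n * ((S + 1) * d) := by
                refine mul_le_mul_of_nonneg_left ?_ (Nat.cast_nonneg _)
                nlinarith
              linarith)
          exact wins_of_le _ hi
        · obtain ⟨w, rfl⟩ := Nat.exists_eq_add_of_le' hw0
          exact ih (r + 1) w (2 * B) y (by omega) hrS hy (by linarith)
            (by rw [pow_succ] at hw; linarith) h2
      · refine ih r (w + 2) (B / 4) y (by omega) (by omega) hy ?_ ?_ ?_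
        · rw [pow_succ] at hB; linarith
        · rw [pow_add]; linarith
        · refine h2.trans (le_of_eq ?_)
          congr 1
          push_cast; ring
    · have h1 : ((1024 * d ^ 3 : ℕ) : ℝ) * (B / (128 * d ^ 2)) = 8 * d * B := by
        push_cast; field_simp; ring
      rw [h1, le_add_iff_nonneg_left]
      exact Finset.sum_nonneg fun _ _ => Finset.sum_nonneg fun _ _ => le_max_left _ _

theorem fillerCanForce_mul {n d S t : ℕ} (hd : 1 ≤ d) (hn : 32 * d * 4 ^ (S + 1) ≤ n)
    (ht : 4 * (S + 1) * (1024 * d ^ 3) ≤ t) : FillerCanForce n t (S * d : ℝ) := by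
  have hd0 : (0 : ℝ) < d := by exact_mod_cast hd
  have hn0 : 0 < n := lt_of_lt_of_le (by positivity) hn
  have hn' : 32 * (d : ℝ) * 4 ^ (S + 1) ≤ n := by exact_mod_cast hn
  refine Wins.fillerCanForce (holdMove ⟨0, hn0⟩) (Wins.mono hn0 ht ?_)
  have h4 : (0 : ℝ) < 4 ^ (S + 1) := by positivity
  -- Starting at r = S + 1 means measuring from height -d, where empty cups already have excess nd.
  refine wins_stages hn0 hd (D := n * d / 4 ^ (S + 1)) ?_ (4 * (S + 1)) (S + 1) (S + 1) (n * d)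
    _ (by omega) le_rfl (fun i => ⟨0, by simp⟩) ?_ ?_ ?_
  · rw [le_div_iff₀ h4]; nlinarith
  · rw [div_mul_cancel₀ _ h4.ne']
  · have h2 : ((S : ℝ) + 1) ≤ 2 ^ (S + 1) := by exact_mod_cast (Nat.lt_two_pow_self).le
    have : (0 : ℝ) ≤ n * d := by positivity
    nlinarith
  · refine le_of_eq ?_
    simp [excess]

theorem fillerCanForce_half {n t : ℕ} (hn : 2 ≤ n) (ht : 1 ≤ t) :
    FillerCanForce n t (1 / 2) := by
  have hn0 : 0 < n := by omega
  refine Wins.fillerCanForce (holdMove ⟨0, hn0⟩) (Wins.mono hn0 ht ?_)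
  have hx : HalfIntegral (fun _ : Fin n => (0 : ℝ)) := fun i => ⟨0, by simp⟩
  obtain ⟨W, -, hW⟩ := Finset.exists_subset_card_eq
    (show 2 * 1 ≤ (Finset.univ : Finset (Fin n)).card by simpa using hn)
  refine ⟨splitMove (fun _ => 0) 0 W 1 le_rfl hW fun _ _ => rfl, fun e => ?_⟩
  have h1 := excess_add_le_split hx ⟨0, by simp⟩ le_rfl hW (fun _ _ => rfl) e
  have h2 : (0 : ℝ) ≤ excess 0 (fun _ : Fin n => (0 : ℝ)) := by simp [excess]
  obtain ⟨i, hi⟩ := exists_lt_of_excess_pos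
    (lt_of_lt_of_le (by push_cast; linarith) h1)
  obtain ⟨z, hz⟩ := hx.split le_rfl hW (fun _ _ => rfl) e i
  refine wins_of_le 0 (i := i) ?_
  rw [hz] at hi ⊢
  have : z ≠ 0 := by rintro rfl; simp at hi
  have : (1 : ℝ) ≤ z := by exact_mod_cast Nat.one_le_iff_ne_zero.2 this
  linarith

theorem FillerCanForce.mono {n t : ℕ} {b b' : ℝ} (h : FillerCanForce n t b) (hb : b' ≤ b) :
    FillerCanForce n t b' :=
  let ⟨σ, hσ⟩ := h
  ⟨σ, fun ε => hb.trans (hσ ε)⟩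

/-! ### Choice of step size and number of stages -/

theorem exists_stages {k L : ℝ} (hk : 1 ≤ k) (hL : 24 ≤ L) :
    ∃ d S : ℕ, 1 ≤ d ∧ d ≤ 2 * k ∧ (S : ℝ) + 1 ≤ L / 2 + 2 ∧ 1 / 2 * k ≤ S * d ∧
      ((S : ℝ) + 1) * d ^ 3 ≤ 8 * (k + k ^ 3 / L ^ 2) := by
  have hL0 : 0 < L := by linarith
  have hfrac : 0 ≤ k ^ 3 / L ^ 2 := by positivity
  rcases le_or_gt k L with h | h
  · have h1 := Nat.ceil_lt_add_one (show 0 ≤ k / 2 by linarith)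
    have h2 := Nat.le_ceil (k / 2)
    refine ⟨1, ⌈k / 2⌉₊, le_rfl, ?_, ?_, ?_, ?_⟩
    · push_cast; linarith
    · linarith
    · push_cast; linarith
    · push_cast; linarith
  · have h1 := Nat.ceil_lt_add_one (show 0 ≤ L / 2 by linarith)
    have h2 := Nat.le_ceil (L / 2)
    have hkL : 1 < k / L := (one_lt_div hL0).2 h
    have h3 := Nat.ceil_lt_add_one (show 0 ≤ k / L by linarith)
    have h4 := Nat.le_ceil (k / L)
    have h5 : k / L ≤ k := div_le_self (by linarith) (by linarith)
    refine ⟨⌈k / L⌉₊, ⌈L / 2⌉₊, Nat.ceil_pos.2 (by linarith), by linarith, by linarith, ?_, ?_⟩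
    · calc 1 / 2 * k = L / 2 * (k / L) := by field_simp
        _ ≤ _ := mul_le_mul h2 h4 (by linarith) (by positivity)
    · calc ((⌈L / 2⌉₊ : ℝ) + 1) * (⌈k / L⌉₊ : ℝ) ^ 3 ≤ L * (2 * (k / L)) ^ 3 := by
            refine mul_le_mul (by linarith) (pow_le_pow_left₀ (by positivity) (by linarith) 3)
              (by positivity) hL0.le
        _ = 8 * (k ^ 3 / L ^ 2) := by field_simp; ring
        _ ≤ _ := by linarith

/-- The filler forces backlog `k / 2` at every time past the threshold. -/
theorem fillerCanForce_of_threshold_le {n t : ℕ} {k : ℝ} (hk : 1 ≤ k)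
    (hkn : k ≤ Real.exp (-24) * n)
    (ht : 32768 * (k + k ^ 3 / Real.log (n / k) ^ 2) ≤ t) : FillerCanForce n t (1 / 2 * k) := by
  have hk0 : 0 < k := by linarith
  have hratio : Real.exp 24 ≤ n / k := by
    rw [le_div_iff₀ hk0]
    calc Real.exp 24 * k ≤ Real.exp 24 * (Real.exp (-24) * n) :=
          mul_le_mul_of_nonneg_left hkn (Real.exp_pos _).le
      _ = n := by rw [← mul_assoc, ← Real.exp_add]; simp
  have hpos : 0 < n / k := (Real.exp_pos _).trans_le hratio
  set L := Real.log (n / k) with hL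
  have hL24 : 24 ≤ L := (Real.le_log_iff_exp_le hpos).2 hratio
  have hn : k * Real.exp L = n := by rw [hL, Real.exp_log hpos]; field_simp
  obtain ⟨d, S, hd, hdk, hSL, hSd, hT⟩ := exists_stages hk hL24
  refine (fillerCanForce_mul hd ?_ ?_).mono hSd
  · have h2 : ∀ a : ℕ, (2 : ℝ) ^ a = Real.exp (a * Real.log 2) := fun a => by
      rw [Real.exp_nat_mul, Real.exp_log (by norm_num)]
    have h3 : (32 * d * 4 ^ (S + 1) : ℝ) ≤ n := by
      calc (32 * d * 4 ^ (S + 1) : ℝ) ≤ 32 * (2 * k) * 4 ^ (S + 1) := by gcongr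
        _ = k * 2 ^ (6 + 2 * (S + 1)) := by rw [pow_add 2, pow_mul]; norm_num; ring
        -- The exponent of 2 is at most L + 10, and (L + 10) log 2 ≤ L holds once L ≥ 24; this fixes
        -- the constant e^(-24).
        _ ≤ k * Real.exp L := by
            refine mul_le_mul_of_nonneg_left ?_ hk0.le
            rw [h2]
            refine Real.exp_le_exp.2 ?_
            push_cast
            have := Real.log_two_lt_d9
            have := Real.log_two_gt_d9
            nlinarith
        _ = n := hn
    exact_mod_cast h3
  · have : (4 * (S + 1) * (1024 * d ^ 3) : ℝ) ≤ t := by linarith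
    exact_mod_cast this

/-! ### Inverting the time bound along the trade-off curve -/

theorem log_pow_four_le {w : ℝ} (hw : 1 ≤ w) : Real.log w ^ 4 ≤ 256 * w := by
  have h := Real.log_le_rpow_div (by linarith : 0 ≤ w) (by norm_num : (0 : ℝ) < 1 / 4)
  calc Real.log w ^ 4 ≤ (w ^ (1 / 4 : ℝ) / (1 / 4)) ^ 4 :=
        pow_le_pow_left₀ (Real.log_nonneg hw) h 4
    _ = 256 * (w ^ (1 / 4 : ℝ)) ^ 4 := by ring
    _ = 256 * w := by
        rw [← Real.rpow_natCast, ← Real.rpow_mul (by linarith)]; norm_num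

/-- These are the bounds needed to apply the threshold theorem with k = βb. In the middle regime z =
n³/t, b³ = t·log²(z + 1), and b⁶(z + 1) ≤ 1024n⁶ shows that log(n/(βb)) is at least log(z + 1)/6. -/
theorem tradeoff_bounds {n t : ℕ} (hn : 2 ≤ n) (ht : 1 ≤ t) {β : ℝ} (hβ : 0 < β)
    (hβ8 : β ≤ 1 / 8) :
    0 < tradeoff n t ∧ tradeoff n t ≤ 4 * t ∧ tradeoff n t ≤ 4 * n ∧
      tradeoff n t ^ 3 ≤ 36 * t * Real.log (n / (β * tradeoff n t)) ^ 2 := by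
  have hn2 : (2 : ℝ) ≤ n := by exact_mod_cast hn
  have ht1 : (1 : ℝ) ≤ t := by exact_mod_cast ht
  have hlogn : Real.log n ≤ n := (Real.log_le_sub_one_of_pos (by linarith)).trans (by linarith)
  unfold tradeoff
  split_ifs with h1 h2
  · refine ⟨by linarith, by linarith, by linarith, ?_⟩
    have hlog : (t : ℝ) / 2 ≤ Real.log (n / (β * t)) := by
      rw [Real.le_log_iff_exp_le (by positivity), le_div_iff₀ (by positivity)]
      have h3 : Real.exp t ≤ n := (Real.le_log_iff_exp_le (by linarith)).1 h1
      have h4 : (t : ℝ) ≤ Real.exp (t / 2) := by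
        have h5 := Real.add_one_le_exp ((t : ℝ) / 4)
        have h6 : Real.exp ((t : ℝ) / 2) = Real.exp (t / 4) ^ 2 := by
          rw [← Real.exp_nat_mul]; congr 1; push_cast; ring
        have h7 := pow_le_pow_left₀ (by positivity) h5 2
        rw [h6]
        nlinarith [sq_nonneg ((t : ℝ) / 4 - 1)]
      have h7 : Real.exp (t : ℝ) = Real.exp (t / 2) * Real.exp (t / 2) := by
        rw [← Real.exp_add]; congr 1; ring
      refine le_trans ?_ h3
      rw [h7]
      refine mul_le_mul_of_nonneg_left ?_ (Real.exp_pos _).le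
      nlinarith
    have := pow_le_pow_left₀ (by positivity) hlog 2
    nlinarith
  · push Not at h1
    have h2' : (t : ℝ) ≤ (n : ℝ) ^ 3 := by exact_mod_cast h2
    have ht0 : (0 : ℝ) < t := by linarith
    set z : ℝ := (n : ℝ) ^ 3 / t with hz
    have hz1 : 1 ≤ z := (one_le_div ht0).2 h2'
    have hzt : z * t = (n : ℝ) ^ 3 := by rw [hz]; field_simp
    have hw : 1 ≤ z + 1 := by linarith
    have hl : 0 < Real.log (z + 1) := Real.log_pos (by linarith)
    have hl4 := log_pow_four_le hw
    have hlt : Real.log (z + 1) ≤ 4 * t := by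
      have h3 : z ≤ (n : ℝ) ^ 3 := div_le_self (by positivity) ht1
      have h4 : z + 1 ≤ (n : ℝ) ^ 4 := by
        have : (1 : ℝ) ≤ (n : ℝ) ^ 3 := one_le_pow₀ (by linarith)
        rw [pow_succ]; nlinarith
      have h5 := Real.log_le_log (by linarith) h4
      rw [Real.log_pow] at h5
      push_cast at h5
      linarith
    set l := Real.log (z + 1) with hldef
    set b : ℝ := (t : ℝ) ^ (1 / 3 : ℝ) * l ^ (2 / 3 : ℝ) with hb
    have hb0 : 0 < b := by positivity
    have hb3 : b ^ 3 = t * l ^ 2 := by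
      rw [hb, mul_pow, ← Real.rpow_natCast, ← Real.rpow_natCast, ← Real.rpow_mul ht0.le,
        ← Real.rpow_mul hl.le, ← Real.rpow_natCast]
      norm_num
    have hb6 : b ^ 6 * (z + 1) ≤ 1024 * (n : ℝ) ^ 6 := by
      calc b ^ 6 * (z + 1) = t ^ 2 * (l ^ 4 * (z + 1)) := by
            rw [show b ^ 6 = (b ^ 3) ^ 2 by ring, hb3]; ring
        _ ≤ t ^ 2 * (256 * (z + 1) * (z + 1)) := by gcongr
        _ ≤ t ^ 2 * (1024 * z ^ 2) := mul_le_mul_of_nonneg_left (by nlinarith) (by positivity)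
        _ = 1024 * (z * t) ^ 2 := by ring
        _ = _ := by rw [hzt]; ring
    refine ⟨hb0, ?_, ?_, ?_⟩
    · refine (pow_le_pow_iff_left₀ hb0.le (by positivity) (by norm_num : (3 : ℕ) ≠ 0)).1 ?_
      rw [hb3]
      calc (t : ℝ) * l ^ 2 ≤ t * (4 * t) ^ 2 := by gcongr
        _ ≤ (4 * (t : ℝ)) ^ 3 := by nlinarith [pow_pos ht0 3]
    · refine (pow_le_pow_iff_left₀ hb0.le (by positivity) (by norm_num : (6 : ℕ) ≠ 0)).1 ?_
      have h3 : b ^ 6 ≤ b ^ 6 * (z + 1) := le_mul_of_one_le_right (by positivity) hw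
      have h4 : (0 : ℝ) ≤ (n : ℝ) ^ 6 := by positivity
      rw [mul_pow]
      linarith
    · have hlog : l / 6 ≤ Real.log (n / (β * b)) := by
        have h6 : z + 1 ≤ (n / (β * b)) ^ 6 := by
          rw [div_pow, le_div_iff₀ (by positivity), mul_pow]
          have h7 : β ^ 6 ≤ (1 / 8) ^ 6 := pow_le_pow_left₀ hβ.le hβ8 6
          have h8 : (0 : ℝ) ≤ b ^ 6 * (z + 1) := by positivity
          have h9 : (0 : ℝ) ≤ (n : ℝ) ^ 6 := by positivity
          calc (z + 1) * (β ^ 6 * b ^ 6) = β ^ 6 * (b ^ 6 * (z + 1)) := by ring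
            _ ≤ (1 / 8) ^ 6 * (b ^ 6 * (z + 1)) := mul_le_mul_of_nonneg_right h7 h8
            _ ≤ (n : ℝ) ^ 6 := by norm_num; linarith
        have h10 := Real.log_le_log (by linarith) h6
        rw [Real.log_pow] at h10
        push_cast at h10
        linarith
      have := pow_le_pow_left₀ (by positivity) hlog 2
      rw [hb3]
      nlinarith
  · push Not at h2
    have h2' : (n : ℝ) ^ 3 < t := by exact_mod_cast h2
    have hn3 : (n : ℝ) ≤ (n : ℝ) ^ 3 := le_self_pow₀ (by linarith) (by norm_num)
    refine ⟨by linarith, by linarith, by linarith, ?_⟩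
    have hlog : 1 ≤ Real.log (n / (β * n)) := by
      rw [Real.le_log_iff_exp_le (by positivity), le_div_iff₀ (by positivity)]
      have := Real.exp_one_lt_d9
      have : Real.exp 1 * β ≤ 1 := by nlinarith
      nlinarith
    have := pow_le_pow_left₀ (by positivity) hlog 2
    nlinarith

theorem exists_fillerCanForce_tradeoff :
    ∃ β : ℝ, 0 < β ∧
      ∀ n t : ℕ, 2 ≤ n → 1 ≤ t → FillerCanForce n t (β * tradeoff n t) := by
  -- The first term gives βb ≤ e^(-24)n from b ≤ 4n; the second makes each of the two terms of the
  -- threshold at most t/2.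
  set β := min (Real.exp (-24) / 4) (1 / (72 * 32768)) with hβdef
  have hβ : 0 < β := by positivity
  have hβ1 : β ≤ Real.exp (-24) / 4 := min_le_left _ _
  have hβ2 : β ≤ 1 / (72 * 32768) := min_le_right _ _
  refine ⟨1 / 2 * β, by positivity, fun n t hn ht => ?_⟩
  obtain ⟨hb, hbt, hbn, hb3⟩ := tradeoff_bounds hn ht hβ (by linarith)
  set b := tradeoff n t
  have ht1 : (1 : ℝ) ≤ t := by exact_mod_cast ht
  rw [mul_assoc]
  rcases le_or_gt (β * b) 1 with hk | hk
  · exact (fillerCanForce_half hn ht).mono (by linarith)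
  refine fillerCanForce_of_threshold_le hk.le ?_ ?_
  · calc β * b ≤ Real.exp (-24) / 4 * (4 * n) := by gcongr
      _ = _ := by ring
  · have h1 : β * b ≤ 1 / (72 * 32768) * (4 * t) := by gcongr
    have h2 : (β * b) ^ 3 / Real.log (n / (β * b)) ^ 2 ≤ 1 / (2 * 32768) * t := by
      rcases eq_or_ne (Real.log (n / (β * b))) 0 with h0 | h0
      · rw [h0]; simp
      rw [div_le_iff₀ (by positivity), mul_pow]
      have h3 : β ^ 3 ≤ 1 / (72 * 32768) :=
        (pow_le_of_le_one hβ.le (by linarith) (by norm_num)).trans hβ2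
      calc β ^ 3 * b ^ 3 ≤ 1 / (72 * 32768) * (36 * t * Real.log (n / (β * b)) ^ 2) := by gcongr
        _ = _ := by ring
    linarith

end CupGame

theorem mainTheorem2 :
    (∃ c β C : ℝ, 0 < c ∧ c < 1 ∧ 0 < β ∧ 0 < C ∧
      ∀ (n : ℕ) (k : ℝ), 1 ≤ k → k ≤ c * (n : ℝ) →
        ∃ T : ℕ, (T : ℝ) ≤ C * (k + k ^ 3 / Real.log ((n : ℝ) / k) ^ 2) ∧
          CupGame.FillerCanForce n T (β * k)) ∧
    (∃ β : ℝ, 0 < β ∧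
      ∀ n t : ℕ, 2 ≤ n → 1 ≤ t → CupGame.FillerCanForce n t (β * CupGame.tradeoff n t)) ∧
    (∃ β C : ℝ, 0 < β ∧ 0 < C ∧
      ∀ n : ℕ, 2 ≤ n →
        ∃ T : ℕ, (T : ℝ) ≤ C * (n : ℝ) ^ 3 ∧ CupGame.FillerCanForce n T (β * (n : ℝ))) := by
  refine ⟨⟨Real.exp (-24), 1 / 2, 32769, Real.exp_pos _, by simp, by norm_num,
    by norm_num, fun n k hk hkn => ?_⟩, CupGame.exists_fillerCanForce_tradeoff, ?_⟩
  · have h0 : 0 ≤ k ^ 3 / Real.log ((n : ℝ) / k) ^ 2 := by positivity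
    refine ⟨⌈32768 * (k + k ^ 3 / Real.log ((n : ℝ) / k) ^ 2)⌉₊, ?_,
      CupGame.fillerCanForce_of_threshold_le hk hkn (Nat.le_ceil _)⟩
    have := Nat.ceil_lt_add_one
      (show 0 ≤ 32768 * (k + k ^ 3 / Real.log ((n : ℝ) / k) ^ 2) by linarith)
    linarith
  · obtain ⟨β, hβ, H⟩ := CupGame.exists_fillerCanForce_tradeoff
    -- Time n³ + 1 is the first in the regime where the curve equals n.
    refine ⟨β, 2, hβ, by norm_num, fun n hn => ⟨n ^ 3 + 1, ?_, ?_⟩⟩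
    · have : 1 ≤ n ^ 3 := Nat.one_le_pow _ _ (by omega)
      exact_mod_cast (by omega : n ^ 3 + 1 ≤ 2 * n ^ 3)
    · have h := H n (n ^ 3 + 1) hn (by omega)
      have hn2 : (2 : ℝ) ≤ n := by exact_mod_cast hn
      have h1 : Real.log n < ((n ^ 3 + 1 : ℕ) : ℝ) := by
        have h2 := Real.log_le_sub_one_of_pos (show (0 : ℝ) < n by linarith)
        have h3 : (n : ℝ) ≤ (n : ℝ) ^ 3 := le_self_pow₀ (by linarith) (by norm_num)
        push_cast
        linarith
      rwa [CupGame.tradeoff, if_neg (not_le.2 h1), if_neg (by omega)] at h
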